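/- Let $\sigma_X>0$ and $R_X\ge 0$, and let $f$ be a probability density on $[0,\infty)$ ($f\ge 0$, $\int_0^\infty f(s)\,ds=1$). A distortion profile is a decreasing (i.e. nonincreasing), possibly discontinuous, function $D>0$ of $s\ge 0$, with $D(0^-)=\sigma_X^2$ (put $D(s)=\sigma_X^2$ for $s<0$; $D$ may jump at $0$). It is differentiable almost everywhere. Its rate allocation is the generalized function $R(s)=-\frac12\bigl(D(s)+\frac{D'(s)}{D(s)}\bigr)$ on $[0,\infty)$, where a jump of $D$ at $s$ contributes a Dirac delta of mass $\frac12\log\frac{D(s^-)}{D(s^+)}$; that is, the measure giving each interval $(a,b]$ the mass $\frac12\log\frac{D(a^+)}{D(b^+)}-\frac12\int_{(a,b]\cap[0,\infty)}D(s)\,ds$. Consider the problem \[ \text{minimize } \int_0^\infty f(s)D(s)\,ds \] over all distortion profiles $D$ subject to \[ -\tfrac12\log\sigma_X^{-2}-\tfrac12\lim_{z\to\infty}\Bigl(\log D(z)+\int_0^z D(s)\,ds\Bigr)\le R_X , \qquad D'(s)\le -D(s)^2 , \] where the limit is required to be finite and the second constraint is imposed at every $s>0$ at which $D$ is differentiable.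 If $f$ is continuous on $[0,\infty)$ and quasiconcave on $[0,\infty)$ (all its superlevel sets are convex), then there is an $s_{\mathrm a}\ge 0$ such that the single-layer rate allocation $R^*(s)=R_X\,\delta(s-s_{\mathrm a})$ is optimal: the profile \[ D^*(s)=\begin{cases}\dfrac{1}{s+\sigma_X^{-2}}, & 0\le s<s_{\mathrm a},\\[2mm] \dfrac{1}{s-s_{\mathrm a}+(s_{\mathrm a}+\sigma_X^{-2})e^{2R_X}}, & s\ge s_{\mathrm a},\end{cases} \] (with $D^*(s)=\sigma_X^2$ for $s<0$) has rate allocation $R^*$, satisfies the constraints, and attains the minimum. -/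

import Mathlib

open MeasureTheory Set Filter Topology

/-- Feasible distortion profiles for a Gaussian source of variance `σX ^ 2` and total rate `RX`
(nats per symbol). `D s` is the distortion realized in the fading state `s ≥ 0`; the convention
`D s = σX ^ 2` for `s < 0` encodes `D(0⁻) = σX ^ 2`, so that a jump of `D` at `0` is allowed.
A decreasing `D` is differentiable almost everywhere; it may have jumps, and the differential
constraint is imposed wherever `D` is differentiable. -/
structure IsFeasibleProfile (σX RX : ℝ) (D : ℝ → ℝ) : Prop where
  pos : ∀ s, 0 < D s
  antitone : Antitone D
  eq_of_neg : ∀ s < 0, D s = σX ^ 2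
  deriv_le : ∀ s, 0 < s → DifferentiableAt ℝ D s → deriv D s ≤ -(D s) ^ 2
  /-- The total rate is finite (the limit exists in `ℝ`) and at most `RX`. -/
  rate_le : ∃ L : ℝ,
    Tendsto (fun z : ℝ => Real.log (D z) + ∫ s in (0 : ℝ)..z, D s) atTop (𝓝 L) ∧
      -(1 / 2) * Real.log ((σX ^ 2)⁻¹) - (1 / 2) * L ≤ RX

/-- Expected distortion of the profile `D` when the fading state has density `f` on `[0, ∞)`. -/
noncomputable def expectedDistortion (f D : ℝ → ℝ) : ℝ :=
  ∫ s in Ici (0 : ℝ), f s * D s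

/-- `D` solves the problem of minimizing the expected distortion over the feasible profiles. -/
def IsOptimalProfile (f : ℝ → ℝ) (σX RX : ℝ) (D : ℝ → ℝ) : Prop :=
  IsFeasibleProfile σX RX D ∧
    ∀ D' : ℝ → ℝ, IsFeasibleProfile σX RX D' → expectedDistortion f D ≤ expectedDistortion f D'

/-- `ρ` is the rate allocation of the profile `D`: the generalized function
`R(s) = -(1/2) (D(s) + D'(s) / D(s))`, in which every jump of `D` contributes a Dirac delta of mass
`(1/2) log (D(s⁻) / D(s⁺))`, regarded as a measure on the line. Since `D' / D = (log D)'`, jumps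
included, its mass on `(a, b]` is
`(1/2) (log D(a⁺) - log D(b⁺)) - (1/2) ∫ D`, the integral being over the fading states in
`(a, b]`. These values determine `ρ`. -/
def HasRateAllocation (D : ℝ → ℝ) (ρ : Measure ℝ) : Prop :=
  ∀ a b : ℝ, a < b →
    ρ (Ioc a b) = ENNReal.ofReal
      ((1 / 2) * (Real.log (Function.rightLim D a) - Real.log (Function.rightLim D b))
        - (1 / 2) * ∫ s in Ioc a b ∩ Ici (0 : ℝ), D s)

/-- The distortion profile when the whole rate `RX` is spent on a single codeword layer that
targets the fading state `sa`. -/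
noncomputable def singleLayerProfile (σX RX sa s : ℝ) : ℝ :=
  if s < 0 then σX ^ 2
  else if s < sa then 1 / (s + (σX ^ 2)⁻¹)
  else 1 / (s - sa + (sa + (σX ^ 2)⁻¹) * Real.exp (2 * RX))

/-! Let `G' = D G` with `G 0 = σX⁻²`, and `q = exp (-2 RX)`. Then `∫ D` over `[a, b]` is `log (G b /
G a)`, and the constraints become slope bounds: `G D = σX⁻² exp (log D + ∫ D)` is nonincreasing by
the differential constraint, starts at most at `1`, and has limit at least `q`. So `G` grows with
slope between `q` and `1`.

Let `m` maximize `f`. Among such potentials with a prescribed value at `m`, the one with slope `1`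
and then `q` is largest on `[0, m]` and smallest beyond `m`. Hence it minimizes `∫ D` over every
`[a, b]` containing `m`; it belongs to a single-layer profile
(`IsFeasibleProfile.exists_integral_singleLayerProfile_le`). By the layer-cake formula a
quasiconcave density is a mixture of indicators of bounded intervals around `m`, so the comparison
passes to the expected distortion (`expectedDistortion_le_of_forall_integral_le`). What remains is
to minimize a continuous function of the target state over the compact `[0, m]`. -/

/-- The potential `G` of a profile `D`, i.e. the solution of `G' = D G`, `G 0 = σX⁻²`. -/
noncomputable def profilePotential (σX : ℝ) (D : ℝ → ℝ) (s : ℝ) : ℝ :=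
  (σX ^ 2)⁻¹ * Real.exp (∫ t in (0 : ℝ)..s, D t)

lemma profilePotential_pos {σX : ℝ} (hσX : 0 < σX) (D : ℝ → ℝ) (s : ℝ) :
    0 < profilePotential σX D s := by
  unfold profilePotential; positivity

lemma profilePotential_zero (σX : ℝ) (D : ℝ → ℝ) : profilePotential σX D 0 = (σX ^ 2)⁻¹ := by
  simp [profilePotential]

lemma Antitone.integral_eq_log_profilePotential_sub {D : ℝ → ℝ} (hD : Antitone D) {σX : ℝ}
    (hσX : 0 < σX) (a b : ℝ) :
    ∫ t in a..b, D t =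
      Real.log (profilePotential σX D b) - Real.log (profilePotential σX D a) := by
  have hv : (σX ^ 2)⁻¹ ≠ 0 := by positivity
  have h := intervalIntegral.integral_interval_sub_left (μ := volume)
    (hD.intervalIntegrable (a := 0) (b := b)) (hD.intervalIntegrable (a := 0) (b := a))
  simp only [profilePotential]
  rw [Real.log_mul hv (Real.exp_pos _).ne', Real.log_mul hv (Real.exp_pos _).ne',
    Real.log_exp, Real.log_exp, ← h]
  ring

/-! ### Slope bounds for the potential of a feasible profile -/

namespace IsFeasibleProfile

variable {σX RX : ℝ} {D : ℝ → ℝ}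

/-- The monotone function `-log D` increases by at least the integral of its a.e. derivative, jumps
and singular part only adding to the increase; that derivative is at least `D` by the differential
constraint. -/
lemma integral_le_log_sub (hD : IsFeasibleProfile σX RX D) {a b : ℝ} (ha : 0 ≤ a) (hab : a ≤ b) :
    ∫ s in a..b, D s ≤ Real.log (D a) - Real.log (D b) := by
  set h : ℝ → ℝ := fun s => -Real.log (D s) with hh
  have hmono : Monotone h := fun x y hxy =>
    neg_le_neg (Real.log_le_log (hD.pos y) (hD.antitone hxy))
  have h1 := (hmono.monotoneOn (uIcc a b)).intervalIntegral_deriv_mem_uIcc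
  have hle : h a ≤ h b := hmono hab
  rw [uIcc_of_le (by linarith)] at h1
  have h2 : ∫ s in a..b, D s ≤ ∫ s in a..b, deriv h s := by
    apply intervalIntegral.integral_mono_ae_restrict hab hD.antitone.intervalIntegrable
      (hmono.monotoneOn _).intervalIntegrable_deriv
    rw [← restrict_Ioc_eq_restrict_Icc]
    filter_upwards [ae_restrict_of_ae hmono.ae_differentiableAt,
      ae_restrict_mem measurableSet_Ioc] with s hs hs'
    have hs0 : 0 < s := ha.trans_lt hs'.1
    -- Differentiability is known for `h`; it passes to `D = exp (-h)`.
    have hDe : D = fun t => Real.exp (-h t) := by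
      funext t; simp [hh, Real.exp_log (hD.pos t)]
    have hdiff : DifferentiableAt ℝ D s := by
      rw [hDe]; exact hs.neg.exp
    have h3 := hD.deriv_le s hs0 hdiff
    have h4 : HasDerivAt h (-(deriv D s / D s)) s :=
      (hdiff.hasDerivAt.log (hD.pos s).ne').neg
    rw [h4.deriv, le_neg, div_le_iff₀ (hD.pos s)]
    nlinarith
  have := h1.2
  simp only [hh] at this
  linarith

lemma log_add_integral_antitoneOn (hD : IsFeasibleProfile σX RX D) :
    AntitoneOn (fun z => Real.log (D z) + ∫ s in (0 : ℝ)..z, D s) (Ici 0) := by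
  intro a ha b _ hab
  have h := hD.integral_le_log_sub ha hab
  have h2 := intervalIntegral.integral_interval_sub_left (μ := volume)
    (hD.antitone.intervalIntegrable (a := 0) (b := b))
    (hD.antitone.intervalIntegrable (a := 0) (b := a))
  simp only
  linarith

lemma potential_mul_eq (hσX : 0 < σX) (hD : IsFeasibleProfile σX RX D) (s : ℝ) :
    profilePotential σX D s * D s =
      Real.exp (Real.log (σX ^ 2)⁻¹ + (Real.log (D s) + ∫ t in (0 : ℝ)..s, D t)) := by
  rw [Real.exp_add, Real.exp_add, Real.exp_log (by positivity), Real.exp_log (hD.pos s),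
    profilePotential]
  ring

lemma potential_mul_le_one (hσX : 0 < σX) (hD : IsFeasibleProfile σX RX D) {s : ℝ} (hs : 0 ≤ s) :
    profilePotential σX D s * D s ≤ 1 := by
  rw [potential_mul_eq hσX hD, Real.exp_le_one_iff]
  have h1 := hD.log_add_integral_antitoneOn (mem_Ici.2 le_rfl) (mem_Ici.2 hs) hs
  have h2 : Real.log (D 0) ≤ Real.log (σX ^ 2) := by
    -- Any negative state gives `D(0⁻)`; a jump at `0` only lowers `D 0`.
    rw [← hD.eq_of_neg (-1) (by norm_num)]
    exact Real.log_le_log (hD.pos 0) (hD.antitone (by norm_num))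
  simp only [intervalIntegral.integral_same] at h1
  rw [Real.log_inv]
  linarith

lemma exp_le_potential_mul (hσX : 0 < σX) (hD : IsFeasibleProfile σX RX D) {s : ℝ} (hs : 0 ≤ s) :
    Real.exp (-(2 * RX)) ≤ profilePotential σX D s * D s := by
  rw [potential_mul_eq hσX hD, Real.exp_le_exp]
  obtain ⟨L, hL, hR⟩ := hD.rate_le
  have : L ≤ Real.log (D s) + ∫ t in (0 : ℝ)..s, D t := by
    refine le_of_tendsto hL ?_
    filter_upwards [eventually_ge_atTop s] with z hz
    exact hD.log_add_integral_antitoneOn (mem_Ici.2 hs) (mem_Ici.2 (hs.trans hz)) hz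
  linarith

/-- A monotone `D` has countably many discontinuities, and the fundamental theorem of calculus
tolerates a countable exceptional set for the continuous `G`. -/
lemma potential_sub_eq_integral (hD : IsFeasibleProfile σX RX D) {a b : ℝ} (hab : a ≤ b) :
    IntervalIntegrable (fun s => profilePotential σX D s * D s) volume a b ∧
    ∫ s in a..b, profilePotential σX D s * D s =
      profilePotential σX D b - profilePotential σX D a := by
  have hcont : Continuous (profilePotential σX D) :=
    continuous_const.mul (Real.continuous_exp.comp (intervalIntegral.continuous_primitive
      (fun _ _ => hD.antitone.intervalIntegrable) 0))
  have hint : IntervalIntegrable (fun s => profilePotential σX D s * D s) volume a b :=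
    hD.antitone.intervalIntegrable.continuousOn_mul hcont.continuousOn
  refine ⟨hint, integral_eq_of_hasDerivAt_off_countable_of_le _ _ hab
    hD.antitone.countable_not_continuousAt hcont.continuousOn (fun x hx => ?_) hint⟩
  have hx' : ContinuousAt D x := by simpa using hx.2
  have h := (intervalIntegral.integral_hasDerivAt_right
    (hD.antitone.intervalIntegrable (a := 0) (b := x))
    (hD.antitone.measurable.stronglyMeasurable.stronglyMeasurableAtFilter) hx').exp.const_mul
      (σX ^ 2)⁻¹
  exact h.congr_deriv (mul_assoc _ _ _).symm

lemma potential_sub_le (hσX : 0 < σX) (hD : IsFeasibleProfile σX RX D) {a b : ℝ} (ha : 0 ≤ a)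
    (hab : a ≤ b) : profilePotential σX D b - profilePotential σX D a ≤ b - a := by
  obtain ⟨hi, he⟩ := hD.potential_sub_eq_integral hab
  rw [← he]
  have := intervalIntegral.integral_mono_on hab hi (intervalIntegrable_const (c := (1 : ℝ)))
    (fun s hs => hD.potential_mul_le_one hσX (ha.trans hs.1))
  simpa using this

lemma le_potential_sub (hσX : 0 < σX) (hD : IsFeasibleProfile σX RX D) {a b : ℝ} (ha : 0 ≤ a)
    (hab : a ≤ b) :
    Real.exp (-(2 * RX)) * (b - a) ≤ profilePotential σX D b - profilePotential σX D a := by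
  obtain ⟨hi, he⟩ := hD.potential_sub_eq_integral hab
  rw [← he]
  have := intervalIntegral.integral_mono_on hab
    (intervalIntegrable_const (c := Real.exp (-(2 * RX)))) hi
    (fun s hs => hD.exp_le_potential_mul hσX (ha.trans hs.1))
  simpa [mul_comm] using this

lemma le_variance (hD : IsFeasibleProfile σX RX D) (s : ℝ) : D s ≤ σX ^ 2 := by
  have h := hD.eq_of_neg (min s 0 - 1) (by linarith [min_le_right s 0])
  rw [← h]
  exact hD.antitone (by linarith [min_le_left s 0])

end IsFeasibleProfile

/-! ### Unimodal weights -/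

lemma Convex.bddAbove_of_volume_lt_top {S : Set ℝ} (hS : Convex ℝ S)
    (hvol : volume S < ⊤) : BddAbove S := by
  by_contra h
  rcases S.eq_empty_or_nonempty with rfl | ⟨x, hx⟩
  · exact h bddAbove_empty
  have : Ici x ⊆ S := by
    intro y hy
    obtain ⟨z, hz, hyz⟩ := not_bddAbove_iff.1 h y
    exact hS.ordConnected.out hx hz ⟨hy, hyz.le⟩
  have h2 := measure_mono (μ := volume) this
  rw [Real.volume_Ici, top_le_iff] at h2
  exact hvol.ne h2

section Weight

variable {f : ℝ → ℝ}

lemma bddAbove_superlevel (hf_int : IntegrableOn f (Ici 0))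
    (hf_quasi : QuasiconcaveOn ℝ (Ici 0) f) {t : ℝ} (ht : 0 < t) :
    BddAbove {s | s ∈ Ici (0 : ℝ) ∧ t ≤ f s} := by
  refine Convex.bddAbove_of_volume_lt_top (hf_quasi t) ?_
  have h := Integrable.measure_ge_lt_top hf_int ht
  have h2 : volume (Ici (0 : ℝ) ∩ {a | t ≤ f a}) ≤ (volume.restrict (Ici 0)) {a | t ≤ f a} := by
    rw [inter_comm]; exact Measure.le_restrict_apply _ _
  exact h2.trans_lt h

lemma exists_isMaxOn_Ici (hf_int : IntegrableOn f (Ici 0)) (hf_cont : ContinuousOn f (Ici 0))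
    (hf_quasi : QuasiconcaveOn ℝ (Ici 0) f) {x : ℝ} (hx : 0 ≤ x) (hfx : 0 < f x) :
    ∃ m, 0 ≤ m ∧ ∀ s, 0 ≤ s → f s ≤ f m := by
  obtain ⟨B, hB⟩ := bddAbove_superlevel hf_int hf_quasi hfx
  have hxB : x ≤ B := hB ⟨hx, le_rfl⟩
  obtain ⟨m, hm, hmax⟩ := isCompact_Icc.exists_isMaxOn ⟨x, hx, hxB⟩
    (hf_cont.mono (Icc_subset_Ici_self : Icc 0 B ⊆ Ici 0))
  refine ⟨m, hm.1, fun s hs => ?_⟩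
  rcases le_or_gt (f x) (f s) with h | h
  · exact hmax ⟨hs, hB ⟨hs, h⟩⟩
  · exact h.le.trans (hmax ⟨hx, hxB⟩)

/-- A bounded order-connected set lies between the open and closed intervals with its endpoints,
which differ by a null set. -/
lemma setLIntegral_le_of_ordConnected {D E : ℝ → ℝ} (hD : Antitone D) (hE : Antitone E)
    (hD0 : ∀ s, 0 ≤ D s) (hE0 : ∀ s, 0 ≤ E s) {m : ℝ}
    (h : ∀ a b, 0 ≤ a → a ≤ m → m ≤ b → ∫ s in a..b, D s ≤ ∫ s in a..b, E s)
    {S : Set ℝ} (hS : OrdConnected S) (hS0 : S ⊆ Ici 0) (hbdd : BddAbove S) (hm : m ∈ S) :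
    ∫⁻ s in S, ENNReal.ofReal (D s) ≤ ∫⁻ s in S, ENNReal.ofReal (E s) := by
  have hbelow : BddBelow S := ⟨0, hS0⟩
  have key : ∀ F : ℝ → ℝ, Antitone F → (∀ s, 0 ≤ F s) →
      ∫⁻ s in Ioc (sInf S) (sSup S), ENNReal.ofReal (F s) =
        ENNReal.ofReal (∫ s in sInf S..sSup S, F s) := by
    intro F hF hF0
    have hle : sInf S ≤ sSup S := (csInf_le hbelow hm).trans (le_csSup hbdd hm)
    rw [intervalIntegral.integral_of_le hle, ofReal_integral_eq_lintegral_ofReal]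
    · exact (hF.intervalIntegrable (a := sInf S) (b := sSup S)).1
    · exact Eventually.of_forall hF0
  calc ∫⁻ s in S, ENNReal.ofReal (D s)
      ≤ ∫⁻ s in Icc (sInf S) (sSup S), ENNReal.ofReal (D s) :=
        lintegral_mono_set fun x hx => ⟨csInf_le hbelow hx, le_csSup hbdd hx⟩
    _ = ∫⁻ s in Ioc (sInf S) (sSup S), ENNReal.ofReal (D s) :=
        setLIntegral_congr Ioc_ae_eq_Icc.symm
    _ ≤ ∫⁻ s in Ioc (sInf S) (sSup S), ENNReal.ofReal (E s) := by
        rw [key D hD hD0, key E hE hE0]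
        exact ENNReal.ofReal_le_ofReal (h _ _ (le_csInf ⟨m, hm⟩ hS0) (csInf_le hbelow hm)
          (le_csSup hbdd hm))
    _ = ∫⁻ s in Ioo (sInf S) (sSup S), ENNReal.ofReal (E s) :=
        setLIntegral_congr Ioo_ae_eq_Ioc.symm
    _ ≤ ∫⁻ s in S, ENNReal.ofReal (E s) := by
        refine lintegral_mono_set fun x hx => ?_
        obtain ⟨y, hy, hyx⟩ := exists_lt_of_csInf_lt ⟨m, hm⟩ hx.1
        obtain ⟨z, hz, hxz⟩ := exists_lt_of_lt_csSup ⟨m, hm⟩ hx.2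
        exact hS.out hy hz ⟨hyx.le, hxz.le⟩

/-- Layer-cake formula for `f` under the measure with density `D` on `[0, ∞)`. -/
lemma lintegral_mul_eq_lintegral_superlevel (hf_nonneg : ∀ s, 0 ≤ s → 0 ≤ f s)
    (hf_int : IntegrableOn f (Ici 0)) {D : ℝ → ℝ} (hD : Antitone D) (hD0 : ∀ s, 0 ≤ D s) :
    ∫⁻ s in Ici (0 : ℝ), ENNReal.ofReal (f s * D s) =
      ∫⁻ t in Ioi (0 : ℝ), ∫⁻ s in {s | t < f s} ∩ Ici 0, ENNReal.ofReal (D s) := by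
  have hDm : Measurable fun s => ENNReal.ofReal (D s) := hD.measurable.ennreal_ofReal
  have hac := withDensity_absolutelyContinuous (volume.restrict (Ici (0 : ℝ)))
    (fun s => ENNReal.ofReal (D s))
  have hfm : AEMeasurable f (volume.restrict (Ici 0)) := hf_int.aestronglyMeasurable.aemeasurable
  have hf0 : 0 ≤ᵐ[volume.restrict (Ici 0)] f := by
    filter_upwards [ae_restrict_mem measurableSet_Ici] with s hs using hf_nonneg s hs
  have h1 := lintegral_eq_lintegral_meas_lt
    ((volume.restrict (Ici (0 : ℝ))).withDensity fun s => ENNReal.ofReal (D s))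
    (hac.ae_le hf0) (hfm.mono_ac hac)
  rw [lintegral_withDensity_eq_lintegral_mul₀ hDm.aemeasurable hfm.ennreal_ofReal] at h1
  simp_rw [withDensity_apply', Measure.restrict_restrict' measurableSet_Ici] at h1
  rw [← h1]
  refine lintegral_congr fun s => ?_
  rw [mul_comm, ENNReal.ofReal_mul (hD0 s)]
  rfl

lemma IntegrableOn.mul_antitone {D : ℝ → ℝ} {c : ℝ} (hf_int : IntegrableOn f (Ici 0))
    (hD : Antitone D) (hD0 : ∀ s, 0 ≤ D s) (hDc : ∀ s, D s ≤ c) :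
    IntegrableOn (fun s => f s * D s) (Ici 0) := by
  refine Integrable.mul_bdd (c := c) hf_int hD.measurable.aestronglyMeasurable ?_
  exact Eventually.of_forall fun s => by rw [Real.norm_of_nonneg (hD0 s)]; exact hDc s

theorem expectedDistortion_le_of_forall_integral_le {D E : ℝ → ℝ} {c : ℝ}
    (hf_nonneg : ∀ s, 0 ≤ s → 0 ≤ f s) (hf_int : IntegrableOn f (Ici 0))
    (hf_quasi : QuasiconcaveOn ℝ (Ici 0) f) {m : ℝ} (hm : 0 ≤ m)
    (hmax : ∀ s, 0 ≤ s → f s ≤ f m) (hD : Antitone D) (hE : Antitone E)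
    (hD0 : ∀ s, 0 ≤ D s) (hE0 : ∀ s, 0 ≤ E s) (hEc : ∀ s, E s ≤ c)
    (h : ∀ a b, 0 ≤ a → a ≤ m → m ≤ b → ∫ s in a..b, D s ≤ ∫ s in a..b, E s) :
    expectedDistortion f D ≤ expectedDistortion f E := by
  have hnn : ∀ F : ℝ → ℝ, (∀ s, 0 ≤ F s) →
      0 ≤ᵐ[volume.restrict (Ici 0)] fun s => f s * F s := fun F hF => by
    filter_upwards [ae_restrict_mem measurableSet_Ici] with s hs
      using mul_nonneg (hf_nonneg s hs) (hF s)
  have hmeas : ∀ F : ℝ → ℝ, Antitone F →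
      AEStronglyMeasurable (fun s => f s * F s) (volume.restrict (Ici 0)) := fun F hF =>
    hf_int.aestronglyMeasurable.mul hF.measurable.aestronglyMeasurable
  unfold expectedDistortion
  rw [integral_eq_lintegral_of_nonneg_ae (hnn D hD0) (hmeas D hD),
    integral_eq_lintegral_of_nonneg_ae (hnn E hE0) (hmeas E hE)]
  refine ENNReal.toReal_mono ?_ ?_
  · have hi := IntegrableOn.mul_antitone hf_int hE hE0 hEc
    rw [← ofReal_integral_eq_lintegral_ofReal hi (hnn E hE0)]
    exact ENNReal.ofReal_ne_top
  rw [lintegral_mul_eq_lintegral_superlevel hf_nonneg hf_int hD hD0,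
    lintegral_mul_eq_lintegral_superlevel hf_nonneg hf_int hE hE0]
  refine setLIntegral_mono' measurableSet_Ioi fun t ht => ?_
  by_cases hmt : t < f m
  · have hset : {s | t < f s} ∩ Ici 0 = {s | s ∈ Ici (0 : ℝ) ∧ t < f s} := by
      ext s; exact and_comm
    refine setLIntegral_le_of_ordConnected hD hE hD0 hE0 h ?_ inter_subset_right ?_ ⟨hmt, hm⟩
    · rw [hset]; exact (hf_quasi.convex_gt t).ordConnected
    · refine BddAbove.mono ?_ (bddAbove_superlevel hf_int hf_quasi ht)
      exact fun s hs => ⟨hs.2, le_of_lt hs.1⟩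
  -- Levels at or above the maximum contribute nothing.
  · have hset : {s | t < f s} ∩ Ici 0 = ∅ := by
      ext s
      simp only [mem_inter_iff, mem_ofPred_eq, mem_Ici, mem_empty_iff_false, iff_false, not_and]
      exact fun h1 h2 => hmt (h1.trans_le (hmax s h2))
    simp [hset]

end Weight

/-! ### Single-layer profiles: potential, rate allocation, feasibility -/

/-- The potential of the single-layer profile: slope `1` up to the target state `sa`, slope
`exp (-2 RX)` beyond. -/
noncomputable def singleLayerPotential (σX RX sa s : ℝ) : ℝ :=
  (σX ^ 2)⁻¹ + min (max s 0) sa + Real.exp (-(2 * RX)) * max (s - sa) 0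

section SingleLayer

variable {σX RX sa : ℝ}

lemma singleLayerPotential_pos (hσX : 0 < σX) (hsa : 0 ≤ sa) (s : ℝ) :
    0 < singleLayerPotential σX RX sa s := by
  have h1 : 0 ≤ min (max s 0) sa := le_min (le_max_right _ _) hsa
  have h2 : 0 ≤ max (s - sa) 0 := le_max_right _ _
  unfold singleLayerPotential
  positivity

lemma singleLayerPotential_monotone : Monotone (singleLayerPotential σX RX sa) := by
  intro a b hab
  unfold singleLayerPotential
  gcongr

lemma continuous_singleLayerPotential :
    Continuous (singleLayerPotential σX RX sa) := by
  unfold singleLayerPotential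
  fun_prop

lemma singleLayerPotential_of_nonpos (hsa : 0 ≤ sa) {s : ℝ} (hs : s ≤ 0) :
    singleLayerPotential σX RX sa s = (σX ^ 2)⁻¹ := by
  rw [singleLayerPotential, max_eq_right hs, min_eq_left hsa, max_eq_right (by linarith)]
  ring

lemma singleLayerPotential_of_le {s : ℝ} (hs : 0 ≤ s) (hsa : s ≤ sa) :
    singleLayerPotential σX RX sa s = (σX ^ 2)⁻¹ + s := by
  rw [singleLayerPotential, max_eq_left hs, min_eq_left hsa, max_eq_right (by linarith)]
  ring

lemma singleLayerPotential_of_ge (hsa : 0 ≤ sa) {s : ℝ} (hs : sa ≤ s) :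
    singleLayerPotential σX RX sa s = (σX ^ 2)⁻¹ + sa + Real.exp (-(2 * RX)) * (s - sa) := by
  rw [singleLayerPotential, max_eq_left (hsa.trans hs), min_eq_right hs, max_eq_left (by linarith)]

lemma singleLayerProfile_eq_div (hσX : 0 < σX) (hsa : 0 ≤ sa) (s : ℝ) :
    singleLayerProfile σX RX sa s =
      (if s < sa then 1 else Real.exp (-(2 * RX))) / singleLayerPotential σX RX sa s := by
  have hG := (singleLayerPotential_pos (RX := RX) hσX hsa s).ne'
  unfold singleLayerProfile
  split_ifs with h1 h2 h2
  · rw [singleLayerPotential_of_nonpos hsa h1.le]; simp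
  · exact absurd (h1.trans_le hsa) h2
  · rw [singleLayerPotential_of_le (not_lt.1 h1) h2.le, add_comm]
  · rw [singleLayerPotential_of_ge hsa (not_lt.1 h2)] at hG ⊢
    have h3 : s - sa + (sa + (σX ^ 2)⁻¹) * Real.exp (2 * RX) =
        Real.exp (2 * RX) * ((σX ^ 2)⁻¹ + sa + Real.exp (-(2 * RX)) * (s - sa)) := by
      have : Real.exp (2 * RX) * Real.exp (-(2 * RX)) = 1 := by
        rw [← Real.exp_add]; simp
      linear_combination (sa - s) * this
    rw [h3, Real.exp_neg, one_div, mul_inv, div_eq_mul_inv]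

lemma singleLayerProfile_pos (hσX : 0 < σX) (hsa : 0 ≤ sa) (s : ℝ) :
    0 < singleLayerProfile σX RX sa s := by
  rw [singleLayerProfile_eq_div hσX hsa]
  refine div_pos ?_ (singleLayerPotential_pos hσX hsa s)
  split_ifs <;> positivity

lemma singleLayerProfile_antitone (hσX : 0 < σX) (hRX : 0 ≤ RX) (hsa : 0 ≤ sa) :
    Antitone (singleLayerProfile σX RX sa) := by
  intro a b hab
  rw [singleLayerProfile_eq_div hσX hsa, singleLayerProfile_eq_div hσX hsa]
  have hq : Real.exp (-(2 * RX)) ≤ 1 := Real.exp_le_one_iff.2 (by linarith)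
  refine div_le_div₀ (by split_ifs <;> positivity) ?_ (singleLayerPotential_pos hσX hsa a)
    (singleLayerPotential_monotone hab)
  split_ifs with h1 h2
  · exact le_rfl
  · exact absurd (hab.trans_lt h1) h2
  · exact hq
  · exact le_rfl

lemma integral_singleLayerProfile (hσX : 0 < σX) (hRX : 0 ≤ RX) (hsa : 0 ≤ sa) {a b : ℝ}
    (ha : 0 ≤ a) (hab : a ≤ b) :
    ∫ s in a..b, singleLayerProfile σX RX sa s =
      Real.log (singleLayerPotential σX RX sa b) - Real.log (singleLayerPotential σX RX sa a) := by
  have hG := fun s => (singleLayerPotential_pos (RX := RX) hσX hsa s).ne'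
  refine integral_eq_of_hasDerivAt_off_countable_of_le
    (fun s => Real.log (singleLayerPotential σX RX sa s)) _ hab (countable_singleton sa)
    (continuous_singleLayerPotential.log hG).continuousOn (fun x hx => ?_)
    (singleLayerProfile_antitone hσX hRX hsa).intervalIntegrable
  have hx0 : 0 < x := ha.trans_lt hx.1.1
  rw [singleLayerProfile_eq_div hσX hsa]
  refine HasDerivAt.log ?_ (hG x)
  rcases lt_or_gt_of_ne (show x ≠ sa from hx.2) with h | h
  · rw [if_pos h]
    refine ((hasDerivAt_id x).const_add (σX ^ 2)⁻¹).congr_of_eventuallyEq ?_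
    filter_upwards [Ioo_mem_nhds hx0 h] with y hy
    exact singleLayerPotential_of_le hy.1.le hy.2.le
  · rw [if_neg h.not_gt]
    have h1 := (((hasDerivAt_id x).sub_const sa).const_mul (Real.exp (-(2 * RX)))).const_add
      ((σX ^ 2)⁻¹ + sa)
    rw [mul_one] at h1
    refine h1.congr_of_eventuallyEq ?_
    filter_upwards [Ioi_mem_nhds h] with y hy
    exact singleLayerPotential_of_ge hsa (le_of_lt hy)

/-- To the right of any state the profile is `1 / (y + c)`, which solves `D' = -D²`. One-sided
derivatives include the jump points, so right-continuity follows as well. -/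
lemma hasDerivWithinAt_singleLayerProfile (hσX : 0 < σX) (hsa : 0 ≤ sa) {s : ℝ} (hs : 0 ≤ s) :
    HasDerivWithinAt (singleLayerProfile σX RX sa) (-(singleLayerProfile σX RX sa s) ^ 2)
      (Ici s) s := by
  have hpos := singleLayerProfile_pos (RX := RX) hσX hsa s
  have key : ∀ c : ℝ, (∀ᶠ y in 𝓝[Ici s] s, singleLayerProfile σX RX sa y = 1 / (y + c)) →
      HasDerivWithinAt (singleLayerProfile σX RX sa) (-(singleLayerProfile σX RX sa s) ^ 2)
      (Ici s) s := by
    intro c hc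
    have hs' := hc.self_of_nhdsWithin (mem_Ici.2 le_rfl)
    have hne : s + c ≠ 0 := by
      intro h; rw [hs', h] at hpos; simp at hpos
    have h1 : HasDerivWithinAt (fun y => 1 / (y + c)) (-1 / (s + c) ^ 2) (Ici s) s := by
      simp only [one_div]
      exact (((hasDerivAt_id s).add_const c).fun_inv hne).hasDerivWithinAt
    refine (h1.congr_of_eventuallyEq hc hs').congr_deriv ?_
    rw [hs']; field_simp
  rcases lt_or_ge s sa with h | h
  · refine key (σX ^ 2)⁻¹ ?_
    filter_upwards [self_mem_nhdsWithin, mem_nhdsWithin_of_mem_nhds (Iio_mem_nhds h)] with y hy hy2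
    rw [singleLayerProfile, if_neg (hs.trans hy).not_gt, if_pos (mem_Iio.1 hy2)]
  · refine key (-sa + (sa + (σX ^ 2)⁻¹) * Real.exp (2 * RX)) ?_
    filter_upwards [self_mem_nhdsWithin] with y hy
    rw [singleLayerProfile, if_neg (hs.trans hy).not_gt, if_neg (h.trans hy).not_gt]
    congr 1; ring

lemma rightLim_singleLayerProfile (hσX : 0 < σX) (hsa : 0 ≤ sa) (s : ℝ) :
    Function.rightLim (singleLayerProfile σX RX sa) s = singleLayerProfile σX RX sa s := by
  refine ContinuousWithinAt.rightLim_eq ?_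
  rcases lt_or_ge s 0 with h | h
  · refine ContinuousAt.continuousWithinAt ?_
    refine (continuousAt_const (y := σX ^ 2)).congr ?_
    filter_upwards [Iio_mem_nhds h] with y hy
    rw [singleLayerProfile, if_pos (mem_Iio.1 hy)]
  · exact (hasDerivWithinAt_singleLayerProfile hσX hsa h).continuousWithinAt

lemma log_singleLayerProfile (hσX : 0 < σX) (hsa : 0 ≤ sa) (s : ℝ) :
    Real.log (singleLayerProfile σX RX sa s) =
      (if s < sa then 0 else -(2 * RX)) - Real.log (singleLayerPotential σX RX sa s) := by
  rw [singleLayerProfile_eq_div hσX hsa, Real.log_div _ (singleLayerPotential_pos hσX hsa s).ne']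
  · split_ifs <;> simp
  · split_ifs
    · exact one_ne_zero
    · positivity

theorem isFeasibleProfile_singleLayerProfile (hσX : 0 < σX) (hRX : 0 ≤ RX) (hsa : 0 ≤ sa) :
    IsFeasibleProfile σX RX (singleLayerProfile σX RX sa) where
  pos := singleLayerProfile_pos hσX hsa
  antitone := singleLayerProfile_antitone hσX hRX hsa
  eq_of_neg s hs := if_pos hs
  deriv_le s hs hd := (UniqueDiffWithinAt.eq_deriv _ (uniqueDiffWithinAt_Ici s)
    hd.hasDerivAt.hasDerivWithinAt (hasDerivWithinAt_singleLayerProfile hσX hsa hs.le)).le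
  rate_le := by
    -- Beyond `sa` the rate functional is constant, and the rate constraint holds with equality.
    refine ⟨-(2 * RX) - Real.log (σX ^ 2)⁻¹, ?_, by linarith⟩
    refine tendsto_const_nhds.congr' ?_
    filter_upwards [eventually_ge_atTop sa] with z hz
    rw [log_singleLayerProfile hσX hsa, if_neg hz.not_gt,
      integral_singleLayerProfile hσX hRX hsa le_rfl (hsa.trans hz),
      singleLayerPotential_of_nonpos hsa le_rfl]
    ring

lemma setIntegral_singleLayerProfile (hσX : 0 < σX) (hRX : 0 ≤ RX) (hsa : 0 ≤ sa) {a b : ℝ}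
    (hab : a ≤ b) :
    ∫ s in Ioc a b ∩ Ici (0 : ℝ), singleLayerProfile σX RX sa s =
      Real.log (singleLayerPotential σX RX sa b) - Real.log (singleLayerPotential σX RX sa a) := by
  rcases le_or_gt 0 a with ha | ha
  · have : Ioc a b ∩ Ici (0 : ℝ) = Ioc a b :=
      inter_eq_left.2 fun x hx => ha.trans hx.1.le
    rw [this, ← intervalIntegral.integral_of_le hab, integral_singleLayerProfile hσX hRX hsa ha hab]
  rcases lt_or_ge b 0 with hb | hb
  · have : Ioc a b ∩ Ici (0 : ℝ) = ∅ :=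
      eq_empty_of_forall_notMem fun x hx => (hx.1.2.trans_lt hb).not_ge hx.2
    rw [this, singleLayerPotential_of_nonpos hsa ha.le, singleLayerPotential_of_nonpos hsa hb.le]
    simp
  · have : Ioc a b ∩ Ici (0 : ℝ) = Icc 0 b := by
      ext x
      exact ⟨fun hx => ⟨hx.2, hx.1.2⟩, fun hx => ⟨⟨ha.trans_le hx.1, hx.2⟩, hx.1⟩⟩
    rw [this, integral_Icc_eq_integral_Ioc, ← intervalIntegral.integral_of_le hb,
      integral_singleLayerProfile hσX hRX hsa le_rfl hb, singleLayerPotential_of_nonpos hsa ha.le,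
      singleLayerPotential_of_nonpos hsa le_rfl]

theorem hasRateAllocation_singleLayerProfile (hσX : 0 < σX) (hRX : 0 ≤ RX) (hsa : 0 ≤ sa) :
    HasRateAllocation (singleLayerProfile σX RX sa) (ENNReal.ofReal RX • Measure.dirac sa) := by
  intro a b hab
  rw [rightLim_singleLayerProfile hσX hsa, rightLim_singleLayerProfile hσX hsa,
    log_singleLayerProfile hσX hsa, log_singleLayerProfile hσX hsa,
    setIntegral_singleLayerProfile hσX hRX hsa hab.le, Measure.smul_apply, smul_eq_mul,
    Measure.dirac_apply' _ measurableSet_Ioc, indicator_apply]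
  by_cases h1 : a < sa <;> by_cases h2 : sa ≤ b
  · rw [if_pos ⟨h1, h2⟩, if_pos h1, if_neg h2.not_gt, Pi.one_apply, mul_one]
    congr 1; ring
  · rw [if_neg fun h => h2 h.2, if_pos h1, if_pos (not_le.1 h2), mul_zero, eq_comm,
      ENNReal.ofReal_eq_zero]
    linarith
  · rw [if_neg fun h => h1 h.1, if_neg h1, if_neg h2.not_gt, mul_zero, eq_comm,
      ENNReal.ofReal_eq_zero]
    linarith
  · exact absurd ((not_lt.1 h1).trans hab.le) h2

end SingleLayer

/-! ### Comparison with a single layer and choice of the target state -/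

/-- Every feasible profile is dominated, for weights with mode `m`, by a single-layer profile
whose potential agrees with that of the given profile at `m`. -/
theorem IsFeasibleProfile.exists_integral_singleLayerProfile_le {σX RX : ℝ} {D : ℝ → ℝ}
    (hσX : 0 < σX) (hRX : 0 ≤ RX) (hD : IsFeasibleProfile σX RX D) {m : ℝ} (hm : 0 ≤ m) :
    ∃ sa ∈ Icc 0 m, ∀ a b, 0 ≤ a → a ≤ m → m ≤ b →
      ∫ s in a..b, singleLayerProfile σX RX sa s ≤ ∫ s in a..b, D s := by
  set q := Real.exp (-(2 * RX)) with hq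
  set v := (σX ^ 2)⁻¹ with hv
  have hG0 : profilePotential σX D 0 = v := profilePotential_zero σX D
  have hm1 := hD.potential_sub_le hσX le_rfl hm
  have hm2 := hD.le_potential_sub hσX le_rfl hm
  rw [hG0, sub_zero] at hm1 hm2
  -- The function is the value at `m` of the single-layer potential with target `x`; its values at
  -- `x = 0` and `x = m` are exactly the two slope bounds on `G m`.
  obtain ⟨sa, hsa, hsaG⟩ := intermediate_value_Icc hm
    (show ContinuousOn (fun x : ℝ => v + x + q * (m - x)) (Icc 0 m) by fun_prop)
    (show profilePotential σX D m ∈ Icc _ _ from ⟨by linarith, by linarith⟩)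
  refine ⟨sa, hsa, fun a b ha ham hmb => ?_⟩
  simp only at hsaG
  rw [integral_singleLayerProfile hσX hRX hsa.1 ha (ham.trans hmb),
    hD.antitone.integral_eq_log_profilePotential_sub hσX]
  refine sub_le_sub (Real.log_le_log (singleLayerPotential_pos hσX hsa.1 b) ?_)
    (Real.log_le_log (profilePotential_pos hσX D a) ?_)
  · have h := hD.le_potential_sub hσX hm hmb
    rw [singleLayerPotential_of_ge hsa.1 (hsa.2.trans hmb)]
    linarith
  -- Before `sa`, compare from `0` with slope at most `1`; after it, compare backwards from `m` with
  -- slope at least `q`.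
  · rcases le_total a sa with h | h
    · have h' := hD.potential_sub_le hσX le_rfl ha
      rw [singleLayerPotential_of_le ha h]
      linarith
    · have h' := hD.le_potential_sub hσX ha ham
      rw [singleLayerPotential_of_ge hsa.1 h]
      linarith

/-- Dominated convergence: for fixed `s ≠ x` the profile is continuous in the target state at `x`,
and the exceptional state `s = x` is null. -/
lemma continuousOn_expectedDistortion_singleLayerProfile {σX RX : ℝ} {f : ℝ → ℝ} (hσX : 0 < σX)
    (hRX : 0 ≤ RX) (hf_int : IntegrableOn f (Ici 0)) :
    ContinuousOn (fun sa => expectedDistortion f (singleLayerProfile σX RX sa)) (Ici 0) := by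
  intro x hx
  unfold expectedDistortion
  refine continuousWithinAt_of_dominated (bound := fun s => ‖f s‖ * σX ^ 2) ?_ ?_
    (hf_int.norm.mul_const _) ?_
  · filter_upwards [self_mem_nhdsWithin] with sa hsa
    exact hf_int.aestronglyMeasurable.mul
      (singleLayerProfile_antitone hσX hRX hsa).measurable.aestronglyMeasurable
  · filter_upwards [self_mem_nhdsWithin] with sa hsa
    refine Eventually.of_forall fun s => ?_
    rw [norm_mul, Real.norm_of_nonneg (singleLayerProfile_pos hσX hsa s).le]
    gcongr
    exact (isFeasibleProfile_singleLayerProfile hσX hRX hsa).le_variance s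
  · filter_upwards [ae_restrict_of_ae (Measure.ae_ne volume x)] with s hs
    refine continuousWithinAt_const.mul ?_
    have h1 : ContinuousWithinAt (fun sa => (if s < sa then 1 else Real.exp (-(2 * RX))) /
        singleLayerPotential σX RX sa s) (Ici 0) x := by
      refine ContinuousWithinAt.div ?_ ?_ (singleLayerPotential_pos hσX hx s).ne'
      · refine ContinuousAt.continuousWithinAt ?_
        rcases lt_or_gt_of_ne hs with h | h
        · refine (continuousAt_const (y := (1 : ℝ))).congr ?_
          filter_upwards [Ioi_mem_nhds h] with y hy
          exact (if_pos hy).symm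
        · refine (continuousAt_const (y := Real.exp (-(2 * RX)))).congr ?_
          filter_upwards [Iio_mem_nhds h] with y hy
          exact (if_neg (not_lt_of_gt hy)).symm
      · unfold singleLayerPotential
        fun_prop
    exact h1.congr (fun y hy => singleLayerProfile_eq_div hσX hy s)
      (singleLayerProfile_eq_div hσX hx s)

theorem proposition3 (σX RX : ℝ) (hσX : 0 < σX) (hRX : 0 ≤ RX)
    (f : ℝ → ℝ) (hf_nonneg : ∀ s, 0 ≤ s → 0 ≤ f s)
    (hf_int : ∫ s in Ici (0 : ℝ), f s = 1)
    (hf_cont : ContinuousOn f (Ici 0))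
    (hf_quasi : QuasiconcaveOn ℝ (Ici 0) f) :
    ∃ sa : ℝ, 0 ≤ sa ∧
      HasRateAllocation (singleLayerProfile σX RX sa)
        (ENNReal.ofReal RX • Measure.dirac sa) ∧
      IsOptimalProfile f σX RX (singleLayerProfile σX RX sa) := by
  have hint : IntegrableOn f (Ici 0) := by
    -- A non-integrable function has integral `0` by convention, not `1`.
    by_contra h
    rw [integral_undef h] at hf_int
    exact zero_ne_one hf_int
  obtain ⟨x, hx, hfx⟩ : ∃ x, 0 ≤ x ∧ 0 < f x := by
    by_contra! h
    have : ∫ s in Ici (0 : ℝ), f s ≤ 0 := setIntegral_nonpos measurableSet_Ici h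
    linarith
  obtain ⟨m, hm, hmax⟩ := exists_isMaxOn_Ici hint hf_cont hf_quasi hx hfx
  -- Targets in `[0, m]` suffice, since the comparison profile always has its target there.
  obtain ⟨sa, hsa, hmin⟩ := isCompact_Icc.exists_isMinOn (nonempty_Icc.2 hm)
    ((continuousOn_expectedDistortion_singleLayerProfile hσX hRX hint).mono
      (Icc_subset_Ici_self : Icc 0 m ⊆ Ici 0))
  refine ⟨sa, hsa.1, hasRateAllocation_singleLayerProfile hσX hRX hsa.1,
    isFeasibleProfile_singleLayerProfile hσX hRX hsa.1, fun D hD => ?_⟩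
  obtain ⟨sb, hsb, hle⟩ := hD.exists_integral_singleLayerProfile_le hσX hRX hm
  exact (hmin hsb).trans (expectedDistortion_le_of_forall_integral_le hf_nonneg hint hf_quasi hm
    hmax (singleLayerProfile_antitone hσX hRX hsb.1) hD.antitone
    (fun s => (singleLayerProfile_pos hσX hsb.1 s).le) (fun s => (hD.pos s).le) hD.le_variance hle)
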